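/- Let $d$ be a nonnegative integer. All processes are $\mathbb{R}^d$-valued, indexed by $t\ge 0$ and defined on one probability space. A process $(X_t)_{t\ge 0}$ is called additive if $X_0=0$ a.s., it is stochastically continuous, it has independent increments, and a.s. its paths are right-continuous in $t\ge 0$ with left limits in $t>0$. An additive process is a Lévy process if its increments are stationary, that is, $X_{t+h}-X_{s+h}\overset{d}{=}X_t-X_s$ for all $s,t,h\ge 0$; it is a semi-Lévy process with period $p>0$ if $X_{t+p}-X_{s+p}\overset{d}{=}X_t-X_s$ for all $s,t\ge 0$. An additive process is recurrent if for every $s\ge 0$ one has $\liminf_{t\to\infty}|X_t-X_s|=0$ a.s., where $|\cdot|$ is the Euclidean norm. **Proposition 4.1.** Let $(Y_t)_{t\ge 0}$ and $(Z_t)_{t\ge 0}$ be two independent Lévy processes on $\mathbb{R}^d$ and let $0<q<p$. Let $(X_t)_{t\ge 0}$ be defined by $X_0=0$ a.s. and, for $n=0,1,2,\dots$, $$ X_t=\begin{cases} X_{np}+Y_t-Y_{np} & (np<t\le np+q),\\ X_{np+q}+Z_t-Z_{np+q} & (np+q<t\le (n+1)p).\end{cases} $$ Then $(X_t)_{t\ge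 0}$ is a semi-Lévy process with period $p$, $(Y_{qt}+Z_{(p-q)t})_{t\ge 0}$ is a Lévy process, and $(X_t)_{t\ge 0}$ is recurrent if and only if $(Y_{qt}+Z_{(p-q)t})_{t\ge 0}$ is recurrent. -/

import Mathlib

open MeasureTheory ProbabilityTheory Filter Topology
open scoped NNReal ENNReal

/-- The path `x : [0, ∞) → E` is right-continuous at every `t ≥ 0` and has left limits
at every `t > 0`. -/
def IsCadlagPath {E : Type*} [TopologicalSpace E] (x : ℝ≥0 → E) : Prop :=
  (∀ t, ContinuousWithinAt x (Set.Ici t) t) ∧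
    ∀ t, 0 < t → ∃ l, Tendsto x (𝓝[<] t) (𝓝 l)

/-- Additive processes on `ℝᵈ`: `X₀ = 0` a.s., stochastic continuity, independent increments,
and (almost all) sample paths right-continuous with left limits. -/
structure IsAdditiveProcess {Ω : Type*} [MeasurableSpace Ω] {d : ℕ}
    (X : ℝ≥0 → Ω → EuclideanSpace ℝ (Fin d)) (P : Measure Ω) : Prop where
  aemeasurable : ∀ t, AEMeasurable (X t) P
  zero : ∀ᵐ ω ∂P, X 0 ω = 0
  stochasticallyContinuous : ∀ t, TendstoInMeasure P X (𝓝 t) (X t)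
  indepIncrements : HasIndepIncrements X P
  cadlag : ∀ᵐ ω ∂P, IsCadlagPath fun t ↦ X t ω

/-- Lévy processes on `ℝᵈ`: additive processes with stationary increments. -/
structure IsLevyProcess {Ω : Type*} [MeasurableSpace Ω] {d : ℕ}
    (X : ℝ≥0 → Ω → EuclideanSpace ℝ (Fin d)) (P : Measure Ω) : Prop
    extends IsAdditiveProcess X P where
  stationaryIncrements : ∀ h s t : ℝ≥0,
    IdentDistrib (fun ω ↦ X (t + h) ω - X (s + h) ω) (fun ω ↦ X t ω - X s ω) P P

/-- Semi-Lévy processes on `ℝᵈ` with period `p > 0`: additive processes whose increments are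
invariant in law under the time shift by `p`. -/
structure IsSemiLevyProcess {Ω : Type*} [MeasurableSpace Ω] {d : ℕ}
    (X : ℝ≥0 → Ω → EuclideanSpace ℝ (Fin d)) (p : ℝ≥0) (P : Measure Ω) : Prop
    extends IsAdditiveProcess X P where
  period_pos : 0 < p
  periodicIncrements : ∀ s t : ℝ≥0,
    IdentDistrib (fun ω ↦ X (t + p) ω - X (s + p) ω) (fun ω ↦ X t ω - X s ω) P P

/-- `s`-recurrence: `liminf_{t → ∞} |X_t - X_s| = 0` a.s. The norm is taken with values in
`[0, ∞]`, where the `liminf` always is the true one (possibly `∞`). -/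
def IsRecurrentFrom {Ω : Type*} [MeasurableSpace Ω] {d : ℕ}
    (X : ℝ≥0 → Ω → EuclideanSpace ℝ (Fin d)) (s : ℝ≥0) (P : Measure Ω) : Prop :=
  ∀ᵐ ω ∂P, liminf (fun t : ℝ≥0 ↦ ‖X t ω - X s ω‖ₑ) atTop = 0

/-- Recurrence: `s`-recurrence for every `s ≥ 0`. -/
def IsRecurrentProcess {Ω : Type*} [MeasurableSpace Ω] {d : ℕ}
    (X : ℝ≥0 → Ω → EuclideanSpace ℝ (Fin d)) (P : Measure Ω) : Prop :=
  ∀ s : ℝ≥0, IsRecurrentFrom X s P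

/-- Almost surely, `X` starts at `0`, follows the increments of `Y` on every `[np, np + q]`,
and follows the increments of `Z` on every `[np + q, (n + 1)p]`. -/
def IsAlternating {Ω : Type*} [MeasurableSpace Ω] {d : ℕ}
    (X Y Z : ℝ≥0 → Ω → EuclideanSpace ℝ (Fin d)) (p q : ℝ≥0) (P : Measure Ω) : Prop :=
  ∀ᵐ ω ∂P, X 0 ω = 0 ∧ ∀ (n : ℕ) (t : ℝ≥0),
    (n * p < t → t ≤ n * p + q → X t ω = X (n * p) ω + Y t ω - Y (n * p) ω) ∧
    (n * p + q < t → t ≤ (n + 1) * p →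
      X t ω = X (n * p + q) ω + Z t ω - Z (n * p + q) ω)

/-! For a semi-Lévy process `X` of period `p`, recurrence depends only on the law of `X p`
(`IsSemiLevyProcess.isRecurrentProcess_iff`). Sampled once per period, `X` is a random walk with
that step law, so recurrence of the walk passes to `X`. Conversely, an Ottaviani inequality bounds
the probability of entering the unit ball during a period by twice that of ending the period in a
larger fixed ball (`IsSemiLevyProcess.measure_exists_dyadic_le`). If the walk had finite expected
occupation of that ball, Borel–Cantelli would contradict recurrence of `X`; so the occupation is
infinite and Chung–Fuchs (`isRecurrentWalk_of_tsum_eq_top`) applies.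

The process `Y (q t) + Z ((p - q) t)` is Lévy, hence semi-Lévy of period `1`, and its value at `1`
has the law of `X p`. Both processes therefore have the same embedded walk.

That `X` is semi-Lévy follows by writing it as a sum of increments of `(Y, Z)` clipped to the
switching intervals: these pieces are independent, and a shift by `p` preserves their laws. -/

/-! ### Regrouping and pairing independent families. -/

section Independence

variable {Ω : Type*} [MeasurableSpace Ω] {P : Measure Ω}

/-- Grouping: the rows of a countable array of independent random variables are independent. -/
lemma iIndepFun_curry {ι κ E : Type*} [Countable ι] [Countable κ] [MeasurableSpace E]
    {D : ι × κ → Ω → E} (hD : ∀ i, AEMeasurable (D i) P) (h : iIndepFun D P) :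
    iIndepFun (fun i ω k ↦ D (i, k) ω) P := by
  have := h.isProbabilityMeasure
  have hm (i) : IsProbabilityMeasure (P.map (D i)) := Measure.isProbabilityMeasure_map (hD i)
  have hrow (i : ι) : AEMeasurable (fun ω k ↦ D (i, k) ω) P :=
    aemeasurable_pi_lambda _ fun k ↦ hD (i, k)
  have hm' (i) : IsProbabilityMeasure (P.map fun ω k ↦ D (i, k) ω) :=
    Measure.isProbabilityMeasure_map (hrow i)
  rw [iIndepFun_iff_map_fun_eq_infinitePi_map₀' hrow]
  have h1 : P.map (fun ω (i : ι × κ) ↦ D i ω) = Measure.infinitePi fun i ↦ P.map (D i) :=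
    (iIndepFun_iff_map_fun_eq_infinitePi_map₀' hD).1 h
  have h2 (i : ι) : P.map (fun ω k ↦ D (i, k) ω) = Measure.infinitePi fun k ↦ P.map (D (i, k)) :=
    (iIndepFun_iff_map_fun_eq_infinitePi_map₀' fun k ↦ hD (i, k)).1
      (h.precomp (Prod.mk_right_injective i))
  have h3 := Measure.infinitePi_map_curry (fun (i : ι) (k : κ) ↦ P.map (D (i, k)))
  simp_rw [h2]
  rw [← h3]
  have h4 : (fun p : ι × κ ↦ P.map (D (p.1, p.2))) = fun p ↦ P.map (D p) := rfl
  rw [h4, ← h1, AEMeasurable.map_map_of_aemeasurable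
    (MeasurableEquiv.measurable _).aemeasurable (aemeasurable_pi_lambda _ hD)]
  rfl

/-- Two independent families of independent random variables can be merged pairwise. -/
lemma iIndepFun_prodMk {ι E F : Type*} [Fintype ι] [MeasurableSpace E] [MeasurableSpace F]
    {f : ι → Ω → E} {g : ι → Ω → F} (hf : iIndepFun f P) (hg : iIndepFun g P)
    (hfg : IndepFun (fun ω i ↦ f i ω) (fun ω i ↦ g i ω) P)
    (mf : ∀ i, AEMeasurable (f i) P) (mg : ∀ i, AEMeasurable (g i) P) :
    iIndepFun (fun i ω ↦ (f i ω, g i ω)) P := by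
  have := hf.isProbabilityMeasure
  have mf' : AEMeasurable (fun ω i ↦ f i ω) P := aemeasurable_pi_lambda _ mf
  have mg' : AEMeasurable (fun ω i ↦ g i ω) P := aemeasurable_pi_lambda _ mg
  have pf (i) : IsProbabilityMeasure (P.map (f i)) := Measure.isProbabilityMeasure_map (mf i)
  have pg (i) : IsProbabilityMeasure (P.map (g i)) := Measure.isProbabilityMeasure_map (mg i)
  have pfg (i) : P.map (fun ω ↦ (f i ω, g i ω)) = (P.map (f i)).prod (P.map (g i)) :=
    (indepFun_iff_map_prod_eq_prod_map_map (mf i) (mg i)).1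
      (hfg.comp (measurable_pi_apply i) (measurable_pi_apply i))
  have e1 := (iIndepFun_iff_map_fun_eq_pi_map mf).1 hf
  have e2 := (iIndepFun_iff_map_fun_eq_pi_map mg).1 hg
  have e3 := (indepFun_iff_map_prod_eq_prod_map_map mf' mg').1 hfg
  rw [e1, e2, ← (measurePreserving_arrowProdEquivProdArrow E F ι _ _).map_eq] at e3
  rw [iIndepFun_iff_map_fun_eq_pi_map (fun i ↦ (mf i).prodMk (mg i))]
  simp_rw [pfg]
  refine (MeasurableEquiv.arrowProdEquivProdArrow E F ι).map_measurableEquiv_injective ?_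
  rw [← e3, AEMeasurable.map_map_of_aemeasurable
    (MeasurableEquiv.measurable _).aemeasurable
    (aemeasurable_pi_lambda _ fun i ↦ (mf i).prodMk (mg i))]
  rfl

end Independence

/-! ### Independent increments: time changes, pairs, cutting along a partition. -/

section Increments

variable {Ω : Type*} [MeasurableSpace Ω] {P : Measure Ω}

lemma HasIndepIncrements_comp_monotone {E : Type*} [MeasurableSpace E] [Sub E]
    {V : ℝ≥0 → Ω → E} (hV : HasIndepIncrements V P) {φ : ℝ≥0 → ℝ≥0} (hφ : Monotone φ) :
    HasIndepIncrements (fun t ↦ V (φ t)) P :=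
  fun n t ht ↦ hV n (fun i ↦ φ (t i)) (hφ.comp ht)

/-- Two independent processes with independent increments, run with different monotone clocks,
form a pair with independent increments. -/
lemma HasIndepIncrements_prodMk {E F : Type*} [MeasurableSpace E] [MeasurableSpace F]
    [AddGroup E] [AddGroup F] [MeasurableSub₂ E] [MeasurableSub₂ F]
    {Y : ℝ≥0 → Ω → E} {Z : ℝ≥0 → Ω → F}
    (hY : HasIndepIncrements Y P) (hZ : HasIndepIncrements Z P)
    (hYZ : IndepFun (fun ω t ↦ Y t ω) (fun ω t ↦ Z t ω) P)
    (mY : ∀ t, AEMeasurable (Y t) P) (mZ : ∀ t, AEMeasurable (Z t) P)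
    {φ ψ : ℝ≥0 → ℝ≥0} (hφ : Monotone φ) (hψ : Monotone ψ) :
    HasIndepIncrements (fun t ω ↦ (Y (φ t) ω, Z (ψ t) ω)) P := by
  intro n t ht
  refine iIndepFun_prodMk (HasIndepIncrements_comp_monotone hY hφ n t ht)
    (HasIndepIncrements_comp_monotone hZ hψ n t ht) ?_
    (fun i ↦ (mY _).sub (mY _)) (fun i ↦ (mZ _).sub (mZ _))
  exact hYZ.comp
    (φ := fun x (i : Fin n) ↦ x (φ (t i.succ)) - x (φ (t i.castSucc)))
    (ψ := fun x (i : Fin n) ↦ x (ψ (t i.succ)) - x (ψ (t i.castSucc)))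
    (by fun_prop) (by fun_prop)

/-- The projection of `t` to the interval `[a, b]`. -/
noncomputable def clip (a b t : ℝ≥0) : ℝ≥0 := max a (min t b)

lemma clip_mono {a b : ℝ≥0} : Monotone (clip a b) :=
  fun _ _ h ↦ max_le_max le_rfl (min_le_min h le_rfl)

lemma clip_of_le {a b t : ℝ≥0} (h : t ≤ a) : clip a b t = a := by
  simp [clip, (min_le_left t b).trans h]

lemma clip_of_ge {a b t : ℝ≥0} (hab : a ≤ b) (h : b ≤ t) : clip a b t = b := by
  simp [clip, h, hab]

lemma clip_of_mem {a b t : ℝ≥0} (ha : a ≤ t) (hb : t ≤ b) : clip a b t = t := by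
  simp [clip, ha, hb]

lemma clip_add (a b t h : ℝ≥0) : clip (a + h) (b + h) (t + h) = clip a b t + h := by
  simp [clip, min_add_add_right, max_add_add_right]

lemma continuous_clip {a b : ℝ≥0} : Continuous (clip a b) := by
  unfold clip; fun_prop

/-- Cut the increments of `V` over `t₀ ≤ ... ≤ tₙ` along consecutive intervals `[b k, b (k + 1)]`:
all the pieces are independent. -/
lemma HasIndepIncrements_clip {E : Type*} [MeasurableSpace E] [Sub E]
    {V : ℝ≥0 → Ω → E} (hV : HasIndepIncrements V P) {b : ℕ → ℝ≥0} (hb : Monotone b)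
    {n : ℕ} {t : Fin (n + 1) → ℝ≥0} (ht : Monotone t) :
    iIndepFun (fun (i : Fin n × ℕ) ω ↦ V (clip (b i.2) (b (i.2 + 1)) (t i.1.succ)) ω -
      V (clip (b i.2) (b (i.2 + 1)) (t i.1.castSucc)) ω) P := by
  -- One monotone sequence runs through all cells: `j = (n + 1) k + i` stands for `t i` clipped to
  -- the `k`-th cell. The wanted pieces are its increments with `i < n`; those with `i = n` lead to
  -- the next cell and are dropped.
  let u : ℕ → ℝ≥0 := fun j ↦ clip (b (j / (n + 1))) (b (j / (n + 1) + 1))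
    (t ⟨j % (n + 1), Nat.mod_lt _ n.succ_pos⟩)
  have hu : Monotone u := by
    refine monotone_nat_of_le_succ fun j ↦ ?_
    by_cases h : j % (n + 1) = n
    · have h1 : (j + 1) / (n + 1) = j / (n + 1) + 1 := by
        rw [Nat.succ_div_of_dvd]
        exact Nat.dvd_of_mod_eq_zero (by rw [Nat.add_mod, h]; simp)
      simp only [u, h1]
      exact (max_le (hb (Nat.le_succ _)) (min_le_right _ _)).trans (le_max_left _ _)
    · have h0 : j % (n + 1) < n + 1 := Nat.mod_lt _ n.succ_pos
      have h2 : (j + 1) % (n + 1) = j % (n + 1) + 1 := by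
        rw [Nat.add_mod, Nat.mod_eq_of_lt (a := 1) (by omega), Nat.mod_eq_of_lt]; omega
      have h1 : (j + 1) / (n + 1) = j / (n + 1) := by
        rw [Nat.succ_div_of_not_dvd]
        intro hd
        have := Nat.mod_eq_zero_of_dvd hd
        omega
      simp only [u, h1, h2]
      exact clip_mono (ht (by simp [Fin.le_def]))
  have key := (hV.nat hu).precomp (g := fun i : Fin n × ℕ ↦ (n + 1) * i.2 + i.1) ?_
  · convert key using 1
    funext i ω
    have h1 : ((n + 1) * i.2 + i.1 : ℕ) / (n + 1) = i.2 := by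
      rw [Nat.mul_add_div n.succ_pos, Nat.div_eq_of_lt (by omega), add_zero]
    have h2 : ((n + 1) * i.2 + i.1 + 1 : ℕ) / (n + 1) = i.2 := by
      rw [add_assoc, Nat.mul_add_div n.succ_pos, Nat.div_eq_of_lt (by omega), add_zero]
    have h3 : ((n + 1) * i.2 + i.1 : ℕ) % (n + 1) = i.1 := by
      rw [Nat.mul_add_mod, Nat.mod_eq_of_lt (by omega)]
    have h4 : ((n + 1) * i.2 + i.1 + 1 : ℕ) % (n + 1) = i.1 + 1 := by
      rw [add_assoc, Nat.mul_add_mod, Nat.mod_eq_of_lt (by omega)]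
    simp only [u, h1, h2, h3, h4]
    rfl
  · rintro ⟨i, k⟩ ⟨i', k'⟩ h
    have h1 := congrArg (· / (n + 1)) h
    have h3 := congrArg (· % (n + 1)) h
    simp only [Nat.mul_add_div n.succ_pos, Nat.mul_add_mod] at h1 h3
    rw [Nat.div_eq_of_lt (by omega), Nat.div_eq_of_lt (by omega)] at h1
    rw [Nat.mod_eq_of_lt (by omega), Nat.mod_eq_of_lt (by omega)] at h3
    simp only [add_zero] at h1
    exact Prod.ext (Fin.ext h3) h1

end Increments

/-! ### Random walks: Ottaviani inequality and Chung–Fuchs criterion. -/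

section Walk

/-- The `n`-th partial sum of the sequence `x`. -/
def partialSum {E : Type*} [AddCommMonoid E] (x : ℕ → E) (n : ℕ) : E :=
  ∑ j ∈ Finset.range n, x j

lemma partialSum_shift {E : Type*} [AddCommGroup E] (x : ℕ → E) (i n : ℕ) :
    partialSum (fun j ↦ x (i + j)) n = partialSum x (i + n) - partialSum x i := by
  simp [partialSum, Finset.sum_range_add]

lemma partialSum_truncate {E : Type*} [AddCommMonoid E] (x : ℕ → E) {i n : ℕ} (h : n ≤ i) :
    partialSum (fun j ↦ if j < i then x j else 0) n = partialSum x n :=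
  Finset.sum_congr rfl fun _ hj ↦ if_pos ((Finset.mem_range.1 hj).trans_le h)

/-- Padding with zeros keeps the past in the full sequence space, so an event about the first `i`
steps is its own preimage under truncation. Independence comes from the disjoint coordinate blocks
`j < i` and `j ≥ i`. -/
lemma indepFun_truncate_shift {E : Type*} [MeasurableSpace E] [Zero E] (ν : ℕ → Measure E)
    [∀ j, IsProbabilityMeasure (ν j)] (i : ℕ) :
    IndepFun (fun (x : ℕ → E) j ↦ if j < i then x j else 0) (fun x j ↦ x (i + j))
      (Measure.infinitePi ν) := by
  have h : iIndepFun (fun (j : ℕ) (x : ℕ → E) ↦ x j) (Measure.infinitePi ν) :=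
    iIndepFun_infinitePi (X := fun _ x ↦ x) fun _ ↦ measurable_id
  have h2 := indep_iSup_of_disjoint (fun j ↦ (measurable_pi_apply j).comap_le) h.iIndep
    (S := Set.Iio i) (T := Set.Ici i)
    (Set.disjoint_left.2 fun j (hj : j < i) (hj' : i ≤ j) ↦ not_le.2 hj hj')
  rw [IndepFun_iff_Indep]
  refine indep_of_indep_of_le h2 ?_ ?_
  · rw [← measurable_iff_comap_le]
    refine @measurable_pi_lambda _ _ _ (_) _ _ fun j ↦ ?_
    by_cases hj : j < i
    · simp only [hj, if_true]
      exact measurable_iff_comap_le.2 (le_iSup₂_of_le j hj le_rfl)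
    · simp only [hj, if_false]
      exact @measurable_const _ _ _ (_) _
  · rw [← measurable_iff_comap_le]
    refine @measurable_pi_lambda _ _ _ (_) _ _ fun j ↦ ?_
    exact measurable_iff_comap_le.2
      (le_iSup₂_of_le (f := fun j (_ : j ∈ Set.Ici i) ↦
        MeasurableSpace.comap (fun x : ℕ → E ↦ x j) _) (i + j) (Nat.le_add_right i j) le_rfl)

variable {E : Type*} [NormedAddCommGroup E] [MeasurableSpace E] [BorelSpace E]
  [SecondCountableTopology E]

@[fun_prop]
lemma measurable_partialSum (n : ℕ) : Measurable fun x : ℕ → E ↦ partialSum x n := by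
  unfold partialSum
  exact Finset.measurable_sum _ fun _ _ ↦ measurable_pi_apply _

variable (ν : ℕ → Measure E) [∀ j, IsProbabilityMeasure (ν j)]

/-- An Ottaviani-type inequality: if from each time `i ∈ [a, N)` the walk ends at distance `< K`
with probability at least `1 / 2`, then entering the ball of radius `R` is at most twice as likely
as ending in the ball of radius `R + K`. -/
lemma measure_exists_norm_partialSum_lt_le {a N : ℕ} {R K : ℝ}
    (hK : ∀ i, a ≤ i → i < N →
      2⁻¹ ≤ Measure.infinitePi ν {x | ‖partialSum x N - partialSum x i‖ < K}) :
    Measure.infinitePi ν {x | ∃ i, a ≤ i ∧ i < N ∧ ‖partialSum x i‖ < R} ≤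
      2 * Measure.infinitePi ν {x | ‖partialSum x N‖ < R + K} := by
  set ρ := Measure.infinitePi ν
  -- Decomposition by the first time `i ≥ a` in the ball: `A i` depends on the steps before `i`, `B
  -- i` on those from `i` on.
  let A : ℕ → Set (ℕ → E) := fun i ↦
    {x | ‖partialSum x i‖ < R ∧ ∀ j, a ≤ j → j < i → R ≤ ‖partialSum x j‖}
  let B : ℕ → Set (ℕ → E) := fun i ↦ {x | ‖partialSum x N - partialSum x i‖ < K}
  have mA (i) : MeasurableSet (A i) := by
    simp only [A, Set.ofPred_and, Set.ofPred_forall]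
    refine (measurableSet_lt (by fun_prop) (by fun_prop)).inter ?_
    exact .iInter fun j ↦ .iInter fun _ ↦ .iInter fun _ ↦
      measurableSet_le (by fun_prop) (by fun_prop)
  have mB (i) : MeasurableSet (B i) := measurableSet_lt (by fun_prop) (by fun_prop)
  have hAB (i) (hi : i < N) : ρ (A i ∩ B i) = ρ (A i) * ρ (B i) := by
    have h := (indepFun_truncate_shift ν i).measure_inter_preimage_eq_mul (A i)
      {x | ‖partialSum x (N - i)‖ < K} (mA i) (measurableSet_lt (by fun_prop) (by fun_prop))
    have e1 : (fun (x : ℕ → E) j ↦ if j < i then x j else 0) ⁻¹' A i = A i := by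
      ext x
      simp only [A, Set.mem_preimage, Set.mem_ofPred_eq, partialSum_truncate x le_rfl]
      refine and_congr_right fun _ ↦ forall_congr' fun j ↦ forall_congr' fun _ ↦
        forall_congr' fun hj ↦ ?_
      rw [partialSum_truncate x hj.le]
    have e2 : (fun (x : ℕ → E) j ↦ x (i + j)) ⁻¹' {x | ‖partialSum x (N - i)‖ < K} = B i := by
      ext x
      simp [B, partialSum_shift, Nat.add_sub_cancel' hi.le]
    rwa [e1, e2] at h
  have hdisj : Set.PairwiseDisjoint (Finset.Ico a N : Set ℕ) A := by
    intro i hi j hj hij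
    refine Set.disjoint_left.2 fun x hx hx' ↦ ?_
    simp only [Finset.coe_Ico, Set.mem_Ico] at hi hj
    rcases lt_or_gt_of_ne hij with h | h
    · exact (hx'.2 i hi.1 h).not_gt hx.1
    · exact (hx.2 j hj.1 h).not_gt hx'.1
  have hcover : {x | ∃ i, a ≤ i ∧ i < N ∧ ‖partialSum x i‖ < R} ⊆ ⋃ i ∈ Finset.Ico a N, A i := by
    rintro x hx
    classical
    have h := Nat.find_spec hx
    simp only [Set.mem_iUnion, Finset.mem_Ico]
    refine ⟨Nat.find hx, ⟨h.1, h.2.1⟩, h.2.2, fun j hj hj' ↦ ?_⟩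
    have := Nat.find_min hx hj'
    by_contra hc
    exact this ⟨hj, hj'.trans h.2.1, not_le.1 hc⟩
  calc ρ {x | ∃ i, a ≤ i ∧ i < N ∧ ‖partialSum x i‖ < R}
      ≤ ∑ i ∈ Finset.Ico a N, ρ (A i) := (measure_mono hcover).trans (measure_biUnion_finset_le _ _)
    _ ≤ ∑ i ∈ Finset.Ico a N, 2 * ρ (A i ∩ B i) := by
        refine Finset.sum_le_sum fun i hi ↦ ?_
        rw [Finset.mem_Ico] at hi
        rw [hAB i hi.2, mul_left_comm]
        calc ρ (A i) = ρ (A i) * (2 * 2⁻¹) := by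
              rw [ENNReal.mul_inv_cancel (by simp) (by simp), mul_one]
          _ ≤ _ := by gcongr; exact hK i hi.1 hi.2
    _ = 2 * ρ (⋃ i ∈ Finset.Ico a N, A i ∩ B i) := by
        rw [← Finset.mul_sum, measure_biUnion_finset
          (hdisj.mono fun i ↦ Set.inter_subset_left) fun i _ ↦ (mA i).inter (mB i)]
    _ ≤ 2 * ρ {x | ‖partialSum x N‖ < R + K} := by
        gcongr
        refine Set.iUnion₂_subset fun i _ x hx ↦ ?_
        have h1 : ‖partialSum x i‖ < R := hx.1.1
        have h2 : ‖partialSum x N - partialSum x i‖ < K := hx.2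
        calc ‖partialSum x N‖ = ‖partialSum x i + (partialSum x N - partialSum x i)‖ := by simp
          _ ≤ _ := norm_add_le _ _
          _ < R + K := add_lt_add h1 h2

/-- A random walk visiting some ball infinitely often in mean almost surely comes back arbitrarily
close to its starting point. -/
lemma measure_forall_le_norm_partialSum_eq_zero (μ : Measure E) [IsProbabilityMeasure μ] {c : E}
    {ε : ℝ} (h : ∑' n, Measure.infinitePi (fun _ : ℕ ↦ μ) {x | ‖partialSum x n - c‖ < ε} = ∞)
    (k : ℕ) :
    Measure.infinitePi (fun _ : ℕ ↦ μ) {x | ∀ n, k ≤ n → 2 * ε ≤ ‖partialSum x n‖} = 0 := by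
  set ρ := Measure.infinitePi fun _ : ℕ ↦ μ
  let B : ℕ → Set (ℕ → E) := fun m ↦ {x | ‖partialSum x m - c‖ < ε}
  let C : Set (ℕ → E) := {x | ∀ n, k ≤ n → 2 * ε ≤ ‖partialSum x n‖}
  let s : ℕ → (ℕ → E) → (ℕ → E) := fun m x j ↦ x (m + j)
  have ms (m) : Measurable (s m) := by fun_prop
  have mB (m) : MeasurableSet (B m) := measurableSet_lt (by fun_prop) (by fun_prop)
  have mC : MeasurableSet C := by
    simp only [C, Set.ofPred_forall]
    exact .iInter fun j ↦ .iInter fun _ ↦ measurableSet_le (by fun_prop) (by fun_prop)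
  have hBC (m) : ρ (B m ∩ s m ⁻¹' C) = ρ (B m) * ρ C := by
    have h := (indepFun_truncate_shift (fun _ ↦ μ) m).measure_inter_preimage_eq_mul (B m) C
      (mB m) mC
    have e1 : (fun (x : ℕ → E) j ↦ if j < m then x j else 0) ⁻¹' B m = B m := by
      ext x
      simp only [B, Set.mem_preimage, Set.mem_ofPred_eq, partialSum_truncate x le_rfl]
    have e2 : ρ (s m ⁻¹' C) = ρ C := by
      rw [← Measure.map_apply (ms m) mC]
      congr 1
      exact Measure.map_infinitePi_infinitePi_of_inj (P := fun _ : ℕ ↦ μ)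
        (f := fun j ↦ m + j) (add_right_injective m)
    rw [e1] at h
    exact h.trans (by rw [e2])
  -- The left side is the expected number of visits to the `ε`-ball around `c` after which the walk
  -- stays `2ε` away from the visited point from `k` steps on. By `hBC` it equals `ρ C` times an
  -- infinite sum, so a finite bound forces `ρ C = 0`.
  have hle : ∑' m, ρ (B m ∩ s m ⁻¹' C) ≤ k := by
    have mG (m) : MeasurableSet (B m ∩ s m ⁻¹' C) := (mB m).inter (ms m mC)
    calc ∑' m, ρ (B m ∩ s m ⁻¹' C)
        = ∫⁻ x, ∑' m, (B m ∩ s m ⁻¹' C).indicator 1 x ∂ρ := by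
          rw [lintegral_tsum fun m ↦ (measurable_one.indicator (mG m)).aemeasurable]
          simp_rw [lintegral_indicator_one (mG _)]
      _ ≤ ∫⁻ _, k ∂ρ := by
          refine lintegral_mono fun x ↦ ?_
          by_cases hx : ∃ m, x ∈ B m ∩ s m ⁻¹' C
          · classical
            have h0 := Nat.find_spec hx
            -- Two points of the `ε`-ball are less than `2ε` apart, so every such visit occurs
            -- within `k` steps of the first one.
            rw [tsum_eq_sum (s := Finset.Ico (Nat.find hx) (Nat.find hx + k))]
            · refine (Finset.sum_le_card_nsmul _ _ 1 fun m _ ↦ ?_).trans (by simp)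
              exact Set.indicator_le_self' (by simp) x
            · intro m hm
              refine Set.indicator_of_notMem (fun hm' ↦ hm ?_) _
              have hge := Nat.find_min' hx hm'
              refine Finset.mem_Ico.2 ⟨hge, ?_⟩
              by_contra! hc
              have h1 := h0.2 (m - Nat.find hx) (by omega)
              have h2 : ‖partialSum x (Nat.find hx) - c‖ < ε := h0.1
              have h3 : ‖partialSum x m - c‖ < ε := hm'.1
              simp only [s, partialSum_shift, Nat.add_sub_cancel' hge] at h1
              have h4 := norm_sub_le (partialSum x m - c) (partialSum x (Nat.find hx) - c)
              rw [sub_sub_sub_cancel_right] at h4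
              linarith
          · push Not at hx
            simp [Set.indicator_of_notMem (hx _)]
      _ = k := by simp [ρ]
  simp_rw [hBC] at hle
  rw [ENNReal.tsum_mul_right, h] at hle
  by_contra hC
  rw [ENNReal.top_mul hC] at hle
  exact absurd hle (by simp)

/-- The random walk with step law `μ` is recurrent. -/
def IsRecurrentWalk (μ : Measure E) : Prop :=
  ∀ᵐ x ∂Measure.infinitePi (fun _ : ℕ ↦ μ), liminf (fun n ↦ ‖partialSum x n‖ₑ) atTop = 0

/-- The **Chung–Fuchs** criterion. -/
lemma isRecurrentWalk_of_tsum_eq_top [ProperSpace E] (μ : Measure E) [IsProbabilityMeasure μ]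
    {R : ℝ} (h : ∑' n, Measure.infinitePi (fun _ : ℕ ↦ μ) {x | ‖partialSum x n‖ < R} = ∞) :
    IsRecurrentWalk μ := by
  have key (ε : ℝ) (hε : 0 < ε) : ∃ c : E,
      ∑' n, Measure.infinitePi (fun _ : ℕ ↦ μ) {x | ‖partialSum x n - c‖ < ε} = ∞ := by
    -- Finitely many `ε`-balls cover the big ball, so one of them has infinite expected occupation.
    obtain ⟨t, -, ht, hcov⟩ := (isCompact_closedBall (0 : E) R).finite_cover_balls hε
    by_contra! hc
    have hfin : ∑ c ∈ ht.toFinset,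
        ∑' n, Measure.infinitePi (fun _ : ℕ ↦ μ) {x | ‖partialSum x n - c‖ < ε} ≠ ∞ :=
      ENNReal.sum_ne_top.2 fun c _ ↦ hc c
    refine hfin (top_le_iff.1 (h ▸ ?_))
    rw [← Summable.tsum_finsetSum fun _ _ ↦ ENNReal.summable]
    refine ENNReal.tsum_le_tsum fun n ↦ ?_
    refine (measure_mono fun x (hx : ‖partialSum x n‖ < R) ↦ ?_).trans
      (measure_biUnion_finset_le _ _)
    have := hcov (show partialSum x n ∈ Metric.closedBall 0 R by simpa using hx.le)
    simpa [dist_eq_norm] using this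
  have h1 : ∀ᵐ x ∂Measure.infinitePi (fun _ : ℕ ↦ μ), ∀ j k : ℕ,
      ∃ n, k ≤ n ∧ ‖partialSum x n‖ < 1 / (j + 1 : ℝ) := by
    rw [ae_all_iff]; intro j
    rw [ae_all_iff]; intro k
    -- Half the target radius, because returning to the starting point doubles it.
    obtain ⟨c, hc⟩ := key (1 / (j + 1 : ℝ) / 2) (by positivity)
    have := measure_forall_le_norm_partialSum_eq_zero μ hc k
    rw [ae_iff]
    convert this using 3
    simp only [not_exists, not_and, not_lt]
    ring_nf
  filter_upwards [h1] with x hx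
  refine le_antisymm (le_of_forall_gt fun b hb ↦ ?_) zero_le
  obtain ⟨r, hr0, hrb⟩ := ENNReal.lt_iff_exists_nnreal_btwn.1 hb
  obtain ⟨j, hj⟩ := exists_nat_one_div_lt (K := ℝ) (ε := r) (by exact_mod_cast hr0)
  refine lt_of_le_of_lt (liminf_le_of_frequently_le' (frequently_atTop.2 fun k ↦ ?_)) hrb
  obtain ⟨n, hkn, hn⟩ := hx j k
  refine ⟨n, hkn, ?_⟩
  rw [enorm_le_coe]
  exact_mod_cast (hn.trans hj).le

end Walk

/-! ### Recurrence of a semi-Lévy process and of its embedded walk. -/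

section SemiLevy

lemma partialSum_increments {E : Type*} [AddCommGroup E] (x : ℝ≥0 → E) (u : ℕ → ℝ≥0) (n : ℕ) :
    partialSum (fun j ↦ x (u (j + 1)) - x (u j)) n = x (u n) - x (u 0) :=
  Finset.sum_range_sub (fun j ↦ x (u j)) n

variable {Ω : Type*} [MeasurableSpace Ω] {P : Measure Ω} {d : ℕ}
  {X : ℝ≥0 → Ω → EuclideanSpace ℝ (Fin d)} {p : ℝ≥0}

lemma IsAdditiveProcess.aemeasurable_sub (hX : IsAdditiveProcess X P) (s t : ℝ≥0) :
    AEMeasurable (fun ω ↦ X t ω - X s ω) P :=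
  (hX.aemeasurable t).sub (hX.aemeasurable s)

lemma measure_setOf_congr {r s : Ω → Prop} (h : ∀ᵐ ω ∂P, r ω ↔ s ω) :
    P {ω | r ω} = P {ω | s ω} :=
  measure_congr (h.mono fun _ hω ↦ propext hω)

lemma IsSemiLevyProcess.identDistrib_add_mul (hX : IsSemiLevyProcess X p P) (k : ℕ) (s t : ℝ≥0) :
    IdentDistrib (fun ω ↦ X (t + k * p) ω - X (s + k * p) ω) (fun ω ↦ X t ω - X s ω) P P := by
  induction k with
  | zero => simpa using IdentDistrib.refl (hX.aemeasurable_sub s t)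
  | succ k ih =>
    have h := (hX.periodicIncrements (s + k * p) (t + k * p)).trans ih
    convert h using 4 <;> push_cast <;> ring_nf

variable [IsProbabilityMeasure P]

/-- The increment over any full period has the law of `X p`. -/
lemma IsSemiLevyProcess.identDistrib_period (hX : IsSemiLevyProcess X p P) (s : ℝ≥0) :
    IdentDistrib (fun ω ↦ X (s + p) ω - X s ω) (X p) P P := by
  have hp := hX.period_pos
  obtain ⟨k, r, hr, rfl⟩ : ∃ (k : ℕ) (r : ℝ≥0), r ≤ p ∧ s = r + k * p := by
    have h1 : (⌊s / p⌋₊ : ℝ≥0) * p ≤ s := by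
      rw [← le_div_iff₀ hp]; exact Nat.floor_le zero_le
    refine ⟨⌊s / p⌋₊, s - ⌊s / p⌋₊ * p, ?_, (tsub_add_cancel_of_le h1).symm⟩
    rw [tsub_le_iff_left, ← add_one_mul, ← div_le_iff₀ hp]
    exact (Nat.lt_floor_add_one _).le
  have h1 := hX.identDistrib_add_mul k r (r + p)
  rw [add_right_comm] at h1
  refine h1.trans ?_
  -- In `X (r + p) - X r = (X p - X r) + (X (r + p) - X p)` the last term is replaced by `X r - X
  -- 0`, which has the same law and is also independent of `X p - X r`.
  have h2 : IdentDistrib (fun ω ↦ X (r + p) ω - X p ω) (fun ω ↦ X r ω - X 0 ω) P P := by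
    simpa using hX.periodicIncrements 0 r
  have i1 : IndepFun (fun ω ↦ X p ω - X r ω) (fun ω ↦ X (r + p) ω - X p ω) P :=
    hX.indepIncrements.indepFun_sub_sub hr le_add_self
  have i2 : IndepFun (fun ω ↦ X p ω - X r ω) (fun ω ↦ X r ω - X 0 ω) P :=
    (hX.indepIncrements.indepFun_sub_sub zero_le hr).symm
  have h3 := ((IdentDistrib.refl (hX.aemeasurable_sub r p)).prodMk h2 i1 i2).comp
    (u := fun z ↦ z.1 + z.2) (by fun_prop)
  have h4 : IdentDistrib (fun ω ↦ X p ω - X 0 ω) (X p) P P := by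
    refine IdentDistrib.of_ae_eq (hX.aemeasurable_sub 0 p) ?_
    filter_upwards [hX.zero] with ω hω using by simp [hω]
  convert h3.trans ?_ using 1
  · funext ω; simp
  · convert h4 using 1
    funext ω; simp

lemma IsAdditiveProcess.map_increments (hX : IsAdditiveProcess X P) {u : ℕ → ℝ≥0}
    (hu : Monotone u) : P.map (fun ω j ↦ X (u (j + 1)) ω - X (u j) ω) =
      Measure.infinitePi fun j ↦ P.map fun ω ↦ X (u (j + 1)) ω - X (u j) ω :=
  (iIndepFun_iff_map_fun_eq_infinitePi_map₀' fun _ ↦ hX.aemeasurable_sub _ _).1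
    (hX.indepIncrements.nat hu)

lemma IsAdditiveProcess.measure_increments (hX : IsAdditiveProcess X P) {u : ℕ → ℝ≥0}
    (hu : Monotone u) {A : Set (ℕ → EuclideanSpace ℝ (Fin d))} (hA : MeasurableSet A) :
    (Measure.infinitePi fun j ↦ P.map fun ω ↦ X (u (j + 1)) ω - X (u j) ω) A =
      P {ω | (fun j ↦ X (u (j + 1)) ω - X (u j) ω) ∈ A} := by
  rw [← hX.map_increments hu, Measure.map_apply_of_aemeasurable
    (aemeasurable_pi_lambda _ fun _ ↦ hX.aemeasurable_sub _ _) hA]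
  rfl

lemma monotone_add_mul (s p : ℝ≥0) : Monotone fun n : ℕ ↦ s + n * p := fun m n h ↦ by
  dsimp only; gcongr

lemma IsSemiLevyProcess.map_period_increments (hX : IsSemiLevyProcess X p P) (s : ℝ≥0) :
    P.map (fun ω (j : ℕ) ↦ X (s + (j + 1 : ℕ) * p) ω - X (s + j * p) ω) =
      Measure.infinitePi fun _ ↦ P.map (X p) := by
  rw [hX.map_increments (monotone_add_mul s p)]
  congr 1
  funext j
  have e : s + (j + 1 : ℕ) * p = s + j * p + p := by push_cast; ring
  rw [← (hX.identDistrib_period (s + j * p)).map_eq, e]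

/-- The liminf over all times is at most the liminf along `s + n p`, where `X - X s` is the walk. -/
lemma IsSemiLevyProcess.isRecurrentProcess_of_isRecurrentWalk (hX : IsSemiLevyProcess X p P)
    (h : IsRecurrentWalk (P.map (X p))) : IsRecurrentProcess X P := by
  intro s
  rw [IsRecurrentWalk, ← hX.map_period_increments s] at h
  have h' := ae_of_ae_map (aemeasurable_pi_lambda _ fun _ ↦ hX.aemeasurable_sub _ _) h
  filter_upwards [h'] with ω hω
  have e (n : ℕ) := partialSum_increments (fun t ↦ X t ω) (fun n : ℕ ↦ s + n * p) n
  simp only [Nat.cast_zero, zero_mul, add_zero] at e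
  simp only [e] at hω
  refine le_antisymm ?_ zero_le
  rw [← hω]
  have ht : Tendsto (fun n : ℕ ↦ s + n * p) atTop atTop :=
    tendsto_atTop_mono (fun _ ↦ le_add_self)
      (tendsto_natCast_atTop_atTop.atTop_mul_const hX.period_pos)
  rw [show (fun n : ℕ ↦ ‖X (s + n * p) ω - X s ω‖ₑ) =
    (fun t ↦ ‖X t ω - X s ω‖ₑ) ∘ fun n : ℕ ↦ s + n * p from rfl, liminf_comp]
  exact liminf_le_liminf_of_le ht

lemma exists_measure_le_norm_le {E : Type*} [NormedAddCommGroup E] [MeasurableSpace E]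
    [BorelSpace E] {f : Ω → E} (hf : AEMeasurable f P) {δ : ℝ≥0∞} (hδ : 0 < δ) :
    ∃ K : ℝ, P {ω | K ≤ ‖f ω‖} ≤ δ := by
  have h := tendsto_measure_iInter_atTop (μ := P) (s := fun n : ℕ ↦ {ω | (n : ℝ) ≤ ‖f ω‖})
    (fun n ↦ nullMeasurableSet_le aemeasurable_const hf.norm)
    (fun m n hmn ω (hω : (n : ℝ) ≤ _) ↦ (Nat.cast_le (α := ℝ).2 hmn).trans hω)
    ⟨0, measure_ne_top _ _⟩
  have h0 : ⋂ n : ℕ, {ω | (n : ℝ) ≤ ‖f ω‖} = ∅ := by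
    ext ω
    obtain ⟨n, hn⟩ := exists_nat_gt ‖f ω‖
    simpa using ⟨n, hn⟩
  rw [h0, measure_empty] at h
  obtain ⟨n, hn⟩ := (h.eventually_le_const hδ).exists
  exact ⟨n, hn⟩

/-- The increments up to time `p` are uniformly tight on `[0, p]`. -/
lemma IsAdditiveProcess.exists_norm_sub_lt (hX : IsAdditiveProcess X P) (p : ℝ≥0) :
    ∃ K : ℝ, ∀ t ≤ p, 2⁻¹ ≤ P {ω | ‖X p ω - X t ω‖ < K} := by
  suffices h : ∃ K : ℝ, ∀ t ∈ Set.Icc 0 p, P {ω | K ≤ ‖X p ω - X t ω‖} ≤ 2⁻¹ by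
    obtain ⟨K, hK⟩ := h
    refine ⟨K, fun t ht ↦ ?_⟩
    have h1 : (1 : ℝ≥0∞) ≤ P {ω | ‖X p ω - X t ω‖ < K} + 2⁻¹ := by
      rw [← measure_univ (μ := P)]
      refine (measure_mono fun ω _ ↦ ?_).trans
        ((measure_union_le _ {ω | K ≤ ‖X p ω - X t ω‖}).trans
          (by gcongr; exact hK t ⟨zero_le, ht⟩))
      exact lt_or_ge ‖X p ω - X t ω‖ K
    rw [← ENNReal.inv_two_add_inv_two] at h1
    exact (ENNReal.add_le_add_iff_right (by simp)).1 h1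
  -- Compactness of `[0, p]` reduces to a bound near each `t₀`: tightness of `X p - X t₀` and
  -- stochastic continuity at `t₀` each cost probability `1 / 4`.
  refine isCompact_Icc.induction_on
    (p := fun S ↦ ∃ K : ℝ, ∀ t ∈ S, P {ω | K ≤ ‖X p ω - X t ω‖} ≤ 2⁻¹) ⟨0, by simp⟩
    (fun S T hST ⟨K, hK⟩ ↦ ⟨K, fun t ht ↦ hK t (hST ht)⟩) ?_ ?_
  · rintro S T ⟨K, hK⟩ ⟨L, hL⟩
    refine ⟨max K L, fun t ht ↦ ?_⟩
    rcases ht with ht | ht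
    · exact (measure_mono fun ω (h : max K L ≤ _) ↦ (le_max_left K L).trans h).trans (hK t ht)
    · exact (measure_mono fun ω (h : max K L ≤ _) ↦ (le_max_right K L).trans h).trans (hL t ht)
  · intro t₀ _
    have hq : (0 : ℝ≥0∞) < 2⁻¹ / 2 := by simp
    obtain ⟨K, hK⟩ := exists_measure_le_norm_le (hX.aemeasurable_sub t₀ p) hq
    have h1 := (hX.stochasticallyContinuous t₀ 1 one_pos).eventually_le_const hq
    refine ⟨_, mem_nhdsWithin_of_mem_nhds h1, K + 1, fun t ht ↦ ?_⟩
    rw [← ENNReal.add_halves 2⁻¹]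
    refine (measure_mono fun ω (hω : K + 1 ≤ ‖X p ω - X t ω‖) ↦ ?_).trans
      ((measure_union_le _ _).trans (add_le_add hK (Set.mem_ofPred_eq ▸ ht)))
    by_contra hc
    simp only [Set.mem_union, Set.mem_ofPred_eq, not_or, not_le] at hc
    have h2 : dist (X t ω) (X t₀ ω) < 1 := by
      have := hc.2
      rwa [edist_dist, ← ENNReal.ofReal_one, ENNReal.ofReal_lt_ofReal_iff one_pos] at this
    rw [dist_comm, dist_eq_norm] at h2
    have h3 := norm_add_le (X p ω - X t₀ ω) (X t₀ ω - X t ω)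
    rw [sub_add_sub_cancel] at h3
    linarith [hc.1]

/-- The probability of entering the unit ball during the `n`-th period, on dyadic times, is
controlled by the position at the end of the period. -/
lemma IsSemiLevyProcess.measure_exists_dyadic_le (hX : IsSemiLevyProcess X p P) {K : ℝ}
    (hK : ∀ t ≤ p, 2⁻¹ ≤ P {ω | ‖X p ω - X t ω‖ < K}) (n : ℕ) :
    P {ω | ∃ m i : ℕ, n * 2 ^ m ≤ i ∧ i < (n + 1) * 2 ^ m ∧ ‖X (i * (p / 2 ^ m)) ω‖ < 1} ≤
      2 * P {ω | ‖X ((n + 1 : ℕ) * p) ω‖ < 1 + K} := by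
  have hU : {ω | ∃ m i : ℕ, n * 2 ^ m ≤ i ∧ i < (n + 1) * 2 ^ m ∧ ‖X (i * (p / 2 ^ m)) ω‖ < 1} =
      ⋃ m : ℕ, {ω | ∃ i : ℕ, n * 2 ^ m ≤ i ∧ i < (n + 1) * 2 ^ m ∧
        ‖X (i * (p / 2 ^ m)) ω‖ < 1} := by
    ext ω; simp
  -- The dyadic grids are nested, so it suffices to treat each level `m`, where the grid increments
  -- form a walk with independent steps.
  rw [hU, Monotone.measure_iUnion]
  · refine iSup_le fun m ↦ ?_
    set u : ℕ → ℝ≥0 := fun i ↦ i * (p / 2 ^ m) with hu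
    have mu : Monotone u := fun i j h ↦ by simp only [hu]; gcongr
    have hend : u ((n + 1) * 2 ^ m) = (n + 1 : ℕ) * p := by
      simp only [hu]; push_cast; field_simp
    have hprob (j) : IsProbabilityMeasure (P.map fun ω ↦ X (u (j + 1)) ω - X (u j) ω) :=
      Measure.isProbabilityMeasure_map (hX.aemeasurable_sub _ _)
    have e (ω : Ω) (k : ℕ) : partialSum (fun j ↦ X (u (j + 1)) ω - X (u j) ω) k =
        X (u k) ω - X (u 0) ω := partialSum_increments (fun t ↦ X t ω) u k
    have h0 : u 0 = 0 := by simp [hu]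
    have h1 := measure_exists_norm_partialSum_lt_le
      (fun j ↦ P.map fun ω ↦ X (u (j + 1)) ω - X (u j) ω)
      (a := n * 2 ^ m) (N := (n + 1) * 2 ^ m) (R := 1) (K := K) ?_
    · rw [hX.measure_increments mu, hX.measure_increments mu] at h1
      · simp only [Set.mem_ofPred_eq, e] at h1
        refine le_trans (le_of_eq (measure_setOf_congr ?_)) (h1.trans_eq ?_)
        · filter_upwards [hX.zero] with ω hω
          simp [hu, hω]
        · congr 1
          refine measure_setOf_congr ?_
          filter_upwards [hX.zero] with ω hω
          rw [hend, h0, hω, sub_zero]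
      · exact measurableSet_lt (by fun_prop) (by fun_prop)
      · simp only [Set.ofPred_exists, Set.ofPred_and]
        exact .iUnion fun i ↦ (MeasurableSet.const _).inter
          ((MeasurableSet.const _).inter (measurableSet_lt (by fun_prop) (by fun_prop)))
    · intro i hi hi'
      rw [hX.measure_increments mu (measurableSet_lt (by fun_prop) (by fun_prop))]
      simp only [Set.mem_ofPred_eq, e, sub_sub_sub_cancel_right]
      have hi1 : n * p ≤ u i := by
        calc n * p = u (n * 2 ^ m) := by simp only [hu]; push_cast; field_simp
          _ ≤ u i := mu hi
      have hi2 : u i ≤ p + n * p := by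
        rw [← one_add_mul, add_comm, ← Nat.cast_succ, ← hend]
        exact mu hi'.le
      -- Periodicity moves the `n`-th period back to `[0, p]`, where `hK` applies.
      have h2 := (hX.identDistrib_add_mul n (u i - n * p) p).measure_mem_eq
        (s := {z | ‖z‖ < K}) (measurableSet_lt (by fun_prop) (by fun_prop))
      rw [tsub_add_cancel_of_le hi1, ← one_add_mul, add_comm 1, ← Nat.cast_succ, ← hend] at h2
      exact (hK _ (tsub_le_iff_right.2 hi2)).trans_eq h2.symm
  · refine monotone_nat_of_le_succ fun m ω ↦ ?_
    rintro ⟨i, h1, h2, h3⟩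
    refine ⟨2 * i, by rw [pow_succ]; linarith, by rw [pow_succ]; linarith, ?_⟩
    have e : ((2 * i : ℕ) : ℝ≥0) * (p / 2 ^ (m + 1)) = i * (p / 2 ^ m) := by
      push_cast
      rw [pow_succ]
      field_simp
    rwa [e]

/-- A right-continuous path entering the unit ball during a period does so at a dyadic time. -/
lemma exists_dyadic_norm_lt {E : Type*} [NormedAddCommGroup E] {x : ℝ≥0 → E} {t : ℝ≥0}
    (hx : ContinuousWithinAt x (Set.Ici t) t) (hp : 0 < p) (h : ‖x t‖ < 1) {n : ℕ}
    (hn : n * p ≤ t) (hn' : t < (n + 1) * p) :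
    ∃ m i : ℕ, n * 2 ^ m ≤ i ∧ i < (n + 1) * 2 ^ m ∧ ‖x (i * (p / 2 ^ m))‖ < 1 := by
  have hδ (m : ℕ) : 0 < p / 2 ^ m := by positivity
  -- The first point of the level-`m` grid not before `t`; it tends to `t` from the right.
  let c : ℕ → ℝ≥0 := fun m ↦ ⌈t / (p / 2 ^ m)⌉₊ * (p / 2 ^ m)
  have h1 (m) : t ≤ c m := by
    rw [← div_le_iff₀ (hδ m)]; exact Nat.le_ceil _
  have h2 (m) : c m ≤ t + p / 2 ^ m := by
    calc c m ≤ (t / (p / 2 ^ m) + 1) * (p / 2 ^ m) := by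
          simp only [c]; gcongr; exact (Nat.ceil_lt_add_one zero_le).le
      _ = t + p / 2 ^ m := by rw [add_mul, div_mul_cancel₀ _ (hδ m).ne', one_mul]
  have hc : Tendsto c atTop (𝓝[≥] t) := by
    refine tendsto_nhdsWithin_iff.2 ⟨tendsto_of_tendsto_of_tendsto_of_le_of_le
      tendsto_const_nhds ?_ h1 h2, .of_forall h1⟩
    have : Tendsto (fun m : ℕ ↦ t + p * (2⁻¹ : ℝ≥0) ^ m) atTop (𝓝 (t + p * 0)) :=
      tendsto_const_nhds.add (tendsto_const_nhds.mul
        (NNReal.tendsto_pow_atTop_nhds_zero_of_lt_one two_inv_lt_one))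
    simpa [div_eq_mul_inv] using this
  have e1 : ∀ᶠ s in 𝓝[≥] t, ‖x s‖ < 1 := hx.norm.eventually_lt_const h
  have e2 : ∀ᶠ s in 𝓝[≥] t, s < (n + 1) * p :=
    mem_nhdsWithin_of_mem_nhds (Iio_mem_nhds hn')
  obtain ⟨m, hm1, hm2⟩ := (hc.eventually (e1.and e2)).exists
  refine ⟨m, ⌈t / (p / 2 ^ m)⌉₊, ?_, ?_, hm1⟩
  · have h3 := hn.trans (h1 m)
    simp only [c] at h3
    rw [← Nat.cast_le (α := ℝ≥0)]
    push_cast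
    refine le_of_mul_le_mul_right ?_ (hδ m)
    refine le_trans (le_of_eq ?_) h3
    field_simp
  · simp only [c] at hm2
    rw [← Nat.cast_lt (α := ℝ≥0)]
    push_cast
    refine lt_of_mul_lt_mul_right ?_ (hδ m).le
    refine hm2.trans_le (le_of_eq ?_)
    field_simp

/-- If the walk's expected occupation of the ball of radius `1 + K` were finite, almost surely only
finitely many periods would meet the unit ball, against `0`-recurrence. -/
lemma IsSemiLevyProcess.isRecurrentWalk_of_isRecurrentFrom (hX : IsSemiLevyProcess X p P)
    (h : IsRecurrentFrom X 0 P) : IsRecurrentWalk (P.map (X p)) := by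
  have hp := hX.period_pos
  have hprob : IsProbabilityMeasure (P.map (X p)) :=
    Measure.isProbabilityMeasure_map (hX.aemeasurable p)
  obtain ⟨K, hK⟩ := hX.exists_norm_sub_lt p
  refine isRecurrentWalk_of_tsum_eq_top (R := 1 + K) _ ?_
  by_contra hfin
  have hmeas (n : ℕ) : Measure.infinitePi (fun _ : ℕ ↦ P.map (X p))
      {x | ‖partialSum x n‖ < 1 + K} = P {ω | ‖X (n * p) ω‖ < 1 + K} := by
    have mS : MeasurableSet {x : ℕ → EuclideanSpace ℝ (Fin d) | ‖partialSum x n‖ < 1 + K} :=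
      measurableSet_lt (by fun_prop) (by fun_prop)
    rw [← hX.map_period_increments 0, Measure.map_apply_of_aemeasurable
      (aemeasurable_pi_lambda _ fun _ ↦ hX.aemeasurable_sub _ _) mS]
    refine measure_setOf_congr ?_
    filter_upwards [hX.zero] with ω hω
    have e := partialSum_increments (fun t ↦ X t ω) (fun n : ℕ ↦ 0 + n * p) n
    simp only [Nat.cast_zero, zero_mul, add_zero, hω, sub_zero, zero_add] at e
    change ‖partialSum _ n‖ < 1 + K ↔ ‖X (n * p) ω‖ < 1 + K
    simp only [zero_add]
    rw [e]
  simp_rw [hmeas] at hfin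
  let A : ℕ → Set Ω := fun n ↦ {ω | ∃ m i : ℕ, n * 2 ^ m ≤ i ∧ i < (n + 1) * 2 ^ m ∧
    ‖X (i * (p / 2 ^ m)) ω‖ < 1}
  have hA : ∑' n, P (A n) ≠ ∞ := by
    refine ne_top_of_le_ne_top (ENNReal.mul_ne_top (a := 2) (by simp) hfin) ?_
    rw [← ENNReal.tsum_mul_left]
    refine (ENNReal.tsum_le_tsum fun n ↦ hX.measure_exists_dyadic_le hK n).trans ?_
    -- The bound for period `n` involves time `(n + 1) p`, hence the shift of index.
    exact ENNReal.tsum_comp_le_tsum_of_injective (add_left_injective 1)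
      fun n : ℕ ↦ 2 * P {ω | ‖X (n * p) ω‖ < 1 + K}
  have hBC : ∀ᵐ ω ∂P, ¬ ∃ᶠ n in atTop, ω ∈ A n := by
    rw [ae_iff]
    simp only [not_not]
    exact measure_setOfPred_frequently_eq_zero (p := fun n ω ↦ ω ∈ A n) hA
  have hfalse : ∀ᵐ ω ∂P, False := by
    filter_upwards [h, hX.zero, hX.cadlag, hBC] with ω h1 h2 h3 h4
    refine h4 (frequently_atTop.2 fun N ↦ ?_)
    have hfr : ∃ᶠ t in atTop, ‖X t ω - X 0 ω‖ₑ < 1 := by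
      refine frequently_lt_of_liminf_lt (by isBoundedDefault) ?_
      rw [h1]
      exact one_pos
    obtain ⟨t, ht, ht1⟩ := frequently_atTop.1 hfr (N * p)
    rw [h2, sub_zero, ← ofReal_norm, ENNReal.ofReal_lt_one] at ht1
    have hn : ⌊t / p⌋₊ * p ≤ t := by
      rw [← le_div_iff₀ hp]; exact Nat.floor_le zero_le
    have hn' : t < (⌊t / p⌋₊ + 1) * p := by
      rw [← div_lt_iff₀ hp]; exact Nat.lt_floor_add_one _
    refine ⟨⌊t / p⌋₊, Nat.le_floor ((le_div_iff₀ hp).2 ht), ?_⟩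
    exact exists_dyadic_norm_lt (h3.1 t) hp ht1 hn hn'
  exact absurd hfalse (by simp [NeZero.ne])

/-- A semi-Lévy process is recurrent if and only if so is its embedded random walk. -/
theorem IsSemiLevyProcess.isRecurrentProcess_iff (hX : IsSemiLevyProcess X p P) :
    IsRecurrentProcess X P ↔ IsRecurrentWalk (P.map (X p)) :=
  ⟨fun h ↦ hX.isRecurrentWalk_of_isRecurrentFrom (h 0),
    hX.isRecurrentProcess_of_isRecurrentWalk⟩

end SemiLevy

/-! ### Stability of càdlàg paths. -/

section Cadlag

variable {E : Type*} [TopologicalSpace E]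

/-- A left limit survives if the clock is constant just before `t`, or approaches `c t` strictly
from below; `hl` asks for one of these. -/
lemma IsCadlagPath.comp {x : ℝ≥0 → E} (hx : IsCadlagPath x) {c : ℝ≥0 → ℝ≥0}
    (hc : Continuous c) (hm : Monotone c)
    (hl : ∀ t, 0 < t → (∃ a, ∀ᶠ s in 𝓝[<] t, c s = a) ∨
      (0 < c t ∧ ∀ᶠ s in 𝓝[<] t, c s < c t)) :
    IsCadlagPath fun t ↦ x (c t) := by
  refine ⟨fun t ↦ (hx.1 (c t)).comp hc.continuousWithinAt fun s hs ↦ hm hs, fun t ht ↦ ?_⟩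
  rcases hl t ht with ⟨a, ha⟩ | ⟨h0, h⟩
  · exact ⟨x a, tendsto_const_nhds.congr' (ha.mono fun s hs ↦ congrArg x hs.symm)⟩
  · obtain ⟨l, hl⟩ := hx.2 (c t) h0
    exact ⟨l, hl.comp (tendsto_nhdsWithin_iff.2 ⟨hc.continuousWithinAt, h⟩)⟩

lemma IsCadlagPath.comp_clip {x : ℝ≥0 → E} (hx : IsCadlagPath x) (a b : ℝ≥0) :
    IsCadlagPath fun t ↦ x (clip a b t) := by
  refine hx.comp continuous_clip clip_mono fun t ht ↦ ?_
  rcases le_or_gt t a with h | h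
  · refine .inl ⟨a, ?_⟩
    filter_upwards [self_mem_nhdsWithin] with s hs using clip_of_le ((le_of_lt hs).trans h)
  rcases le_or_gt t b with h' | h'
  · rw [clip_of_mem h.le h']
    refine .inr ⟨ht, ?_⟩
    filter_upwards [self_mem_nhdsWithin] with s hs
    exact max_lt h ((min_le_left _ _).trans_lt hs)
  · refine .inl ⟨max a b, ?_⟩
    filter_upwards [mem_nhdsWithin_of_mem_nhds (Ioi_mem_nhds h')] with s hs
    rw [clip, min_eq_right (le_of_lt hs)]

lemma IsCadlagPath.comp_mul {x : ℝ≥0 → E} (hx : IsCadlagPath x) {r : ℝ≥0} (hr : 0 < r) :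
    IsCadlagPath fun t ↦ x (r * t) := by
  refine hx.comp (by fun_prop) (fun s t h ↦ by gcongr)
    fun t ht ↦ .inr ⟨mul_pos hr ht, ?_⟩
  filter_upwards [self_mem_nhdsWithin] with s hs using mul_lt_mul_of_pos_left hs hr

lemma IsCadlagPath.congr {x : ℝ≥0 → E}
    (h : ∀ T, ∃ y, IsCadlagPath y ∧ ∀ t < T, x t = y t) : IsCadlagPath x := by
  have h' (t : ℝ≥0) : ∃ y, IsCadlagPath y ∧ x t = y t ∧ x =ᶠ[𝓝 t] y := by
    obtain ⟨y, hy, hxy⟩ := h (t + 1)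
    have ht : t < t + 1 := lt_add_of_pos_right t one_pos
    refine ⟨y, hy, hxy t ht, ?_⟩
    filter_upwards [Iio_mem_nhds ht] with s hs using hxy s hs
  refine ⟨fun t ↦ ?_, fun t ht ↦ ?_⟩
  · obtain ⟨y, hy, e, hxy⟩ := h' t
    exact (hy.1 t).congr_of_eventuallyEq (hxy.filter_mono nhdsWithin_le_nhds) e
  · obtain ⟨y, hy, -, hxy⟩ := h' t
    obtain ⟨l, hl⟩ := hy.2 t ht
    exact ⟨l, hl.congr' (hxy.filter_mono nhdsWithin_le_nhds).symm⟩

lemma isCadlagPath_const (a : E) : IsCadlagPath fun _ ↦ a :=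
  ⟨fun _ ↦ continuousWithinAt_const, fun _ _ ↦ ⟨a, tendsto_const_nhds⟩⟩

variable [AddCommGroup E] [IsTopologicalAddGroup E]

lemma IsCadlagPath.add {x y : ℝ≥0 → E} (hx : IsCadlagPath x) (hy : IsCadlagPath y) :
    IsCadlagPath fun t ↦ x t + y t := by
  refine ⟨fun t ↦ (hx.1 t).add (hy.1 t), fun t ht ↦ ?_⟩
  obtain ⟨l, hl⟩ := hx.2 t ht
  obtain ⟨m, hm⟩ := hy.2 t ht
  exact ⟨l + m, hl.add hm⟩

lemma IsCadlagPath.sub_const {x : ℝ≥0 → E} (hx : IsCadlagPath x) (a : E) :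
    IsCadlagPath fun t ↦ x t - a := by
  simpa only [sub_eq_add_neg] using hx.add (isCadlagPath_const (-a))

lemma IsCadlagPath.sum {ι : Type*} {x : ι → ℝ≥0 → E} (hx : ∀ i, IsCadlagPath (x i))
    (s : Finset ι) : IsCadlagPath fun t ↦ ∑ i ∈ s, x i t := by
  classical
  induction s using Finset.induction_on with
  | empty => simpa using isCadlagPath_const (0 : E)
  | insert i s hi ih => simpa only [Finset.sum_insert hi] using (hx i).add ih

end Cadlag

/-! ### Convergence in measure of sums and time changes. -/

section ConvergenceInMeasure

variable {Ω E ι : Type*} [MeasurableSpace Ω] {P : Measure Ω} [SeminormedAddCommGroup E]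
  {l : Filter ι}

lemma tendstoInMeasure_add {f g : ι → Ω → E} {f' g' : Ω → E} (hf : TendstoInMeasure P f l f')
    (hg : TendstoInMeasure P g l g') :
    TendstoInMeasure P (fun i ω ↦ f i ω + g i ω) l fun ω ↦ f' ω + g' ω := by
  intro ε hε
  have hε' : 0 < ε / 2 := ENNReal.half_pos hε.ne'
  have h := (hf (ε / 2) hε').add (hg (ε / 2) hε')
  rw [add_zero] at h
  refine tendsto_of_tendsto_of_tendsto_of_le_of_le tendsto_const_nhds h (fun _ ↦ zero_le)
    fun i ↦ ?_
  refine (measure_mono fun ω (hω : ε ≤ _) ↦ ?_).trans (measure_union_le _ _)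
  by_contra hc
  simp only [Set.mem_union, Set.mem_ofPred_eq, not_or, not_le] at hc
  have := (edist_add_add_le _ _ _ _).trans_lt (ENNReal.add_lt_add hc.1 hc.2)
  rw [ENNReal.add_halves] at this
  exact this.not_ge hω

lemma tendstoInMeasure_sum {κ : Type*} {f : κ → ι → Ω → E} {f' : κ → Ω → E}
    (h : ∀ k, TendstoInMeasure P (f k) l (f' k)) (s : Finset κ) :
    TendstoInMeasure P (fun i ω ↦ ∑ k ∈ s, f k i ω) l fun ω ↦ ∑ k ∈ s, f' k ω := by
  classical
  induction s using Finset.induction_on with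
  | empty =>
    intro ε hε
    simpa [hε.not_ge] using tendsto_const_nhds
  | insert k s hk ih => simpa only [Finset.sum_insert hk] using tendstoInMeasure_add (h k) ih

lemma tendstoInMeasure_sub_right {f : ι → Ω → E} {f' : Ω → E} (hf : TendstoInMeasure P f l f')
    (g : Ω → E) : TendstoInMeasure P (fun i ω ↦ f i ω - g ω) l fun ω ↦ f' ω - g ω := by
  intro ε hε
  simpa only [edist_sub_right] using hf ε hε

lemma tendstoInMeasure_comp_continuous {X : ℝ≥0 → Ω → E}
    (hX : ∀ t, TendstoInMeasure P X (𝓝 t) (X t)) {c : ℝ≥0 → ℝ≥0} (hc : Continuous c) (t : ℝ≥0) :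
    TendstoInMeasure P (fun s ↦ X (c s)) (𝓝 t) (X (c t)) :=
  fun ε hε ↦ (hX (c t) ε hε).comp (hc.tendsto t)

end ConvergenceInMeasure

/-! ### Processes glued from increments on consecutive intervals. -/

section Concatenation

/-- A path which follows the increments of `y k` on `[b k, b (k + 1)]` is a sum of increments. -/
lemma eq_sum_clip {E : Type*} [AddCommGroup E] {x : ℝ≥0 → E} {y : ℕ → ℝ≥0 → E} {b : ℕ → ℝ≥0}
    (hb : Monotone b) (hb0 : b 0 = 0) (hx0 : x 0 = 0)
    (h : ∀ k t, b k ≤ t → t ≤ b (k + 1) → x t = x (b k) + (y k t - y k (b k))) (N : ℕ) :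
    ∀ t ≤ b N, x t = ∑ k ∈ Finset.range N, (y k (clip (b k) (b (k + 1)) t) - y k (b k)) := by
  induction N with
  | zero =>
    intro t ht
    rw [hb0] at ht
    simp [le_antisymm ht zero_le, hx0]
  | succ N ih =>
    intro t ht
    rw [Finset.sum_range_succ]
    rcases le_total t (b N) with h1 | h1
    · rw [clip_of_le h1, sub_self, add_zero, ih t h1]
    · rw [clip_of_mem h1 ht, h N t h1 ht, ih _ le_rfl]
      congr 1
      refine Finset.sum_congr rfl fun k hk ↦ ?_
      have h2 : b (k + 1) ≤ b N := hb (Finset.mem_range.1 hk)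
      rw [clip_of_ge (hb k.le_succ) h2, clip_of_ge (hb k.le_succ) (h2.trans h1)]

variable {Ω : Type*} [MeasurableSpace Ω] {P : Measure Ω} {d : ℕ}

/-- The process `X` which follows the increments of the components `L k ∘ V` of `V` on the
consecutive intervals `[b k, b (k + 1)]` is additive. -/
lemma isAdditiveProcess_concat {F : Type*} [NormedAddCommGroup F] [NormedSpace ℝ F]
    [MeasurableSpace F] [BorelSpace F] [SecondCountableTopology F]
    {X : ℝ≥0 → Ω → EuclideanSpace ℝ (Fin d)} {V : ℝ≥0 → Ω → F}
    {L : ℕ → F →L[ℝ] EuclideanSpace ℝ (Fin d)} {b : ℕ → ℝ≥0}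
    (hb : Monotone b) (hbt : ∀ t, ∃ N, t < b N)
    (hXV : ∀ᵐ ω ∂P, ∀ N, ∀ t ≤ b N, X t ω = ∑ k ∈ Finset.range N,
      (L k (V (clip (b k) (b (k + 1)) t) ω) - L k (V (b k) ω)))
    (mV : ∀ t, AEMeasurable (V t) P) (hV : HasIndepIncrements V P)
    (hs : ∀ k t, TendstoInMeasure P (fun t ω ↦ L k (V t ω)) (𝓝 t) (fun ω ↦ L k (V t ω)))
    (hc : ∀ k, ∀ᵐ ω ∂P, IsCadlagPath fun t ↦ L k (V t ω)) :
    IsAdditiveProcess X P where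
  aemeasurable t := by
    obtain ⟨N, hN⟩ := hbt t
    have h : AEMeasurable (fun ω ↦ ∑ k ∈ Finset.range N,
        (L k (V (clip (b k) (b (k + 1)) t) ω) - L k (V (b k) ω))) P :=
      Finset.aemeasurable_fun_sum _ fun k _ ↦
        ((L k).measurable.comp_aemeasurable (mV _)).sub ((L k).measurable.comp_aemeasurable (mV _))
    refine h.congr ?_
    filter_upwards [hXV] with ω hω using (hω N t hN.le).symm
  zero := by
    filter_upwards [hXV] with ω hω
    simpa using hω 0 0 zero_le
  stochasticallyContinuous t := by
    obtain ⟨N, hN⟩ := hbt t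
    have h := tendstoInMeasure_sum (fun k ↦ tendstoInMeasure_sub_right
      (tendstoInMeasure_comp_continuous (hs k) (continuous_clip (a := b k) (b := b (k + 1))) t)
      (fun ω ↦ L k (V (b k) ω))) (Finset.range N)
    refine h.congr' ?_ ?_
    · filter_upwards [Iio_mem_nhds hN] with s hsN
      filter_upwards [hXV] with ω hω using (hω N s (le_of_lt hsN)).symm
    · filter_upwards [hXV] with ω hω using (hω N t hN.le).symm
  indepIncrements := by
    intro n t ht
    obtain ⟨N, hN⟩ := hbt (t (Fin.last n))
    -- All pieces (time step, cell) are independent; grouping them by time step leaves independent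
    -- rows, whose sums are the increments of `X`.
    have h1 := iIndepFun_curry (fun i ↦ (mV _).sub (mV _)) (HasIndepIncrements_clip hV hb ht)
    have h2 := h1.comp (fun _ x ↦ ∑ k ∈ Finset.range N, L k (x k)) (fun _ ↦
      Finset.measurable_sum _ fun k _ ↦ (L k).measurable.comp (measurable_pi_apply k))
    refine (iIndepFun_congr fun i ↦ ?_).1 h2
    filter_upwards [hXV] with ω hω
    rw [hω N _ ((ht (Fin.le_last _)).trans hN.le), hω N _ ((ht (Fin.le_last _)).trans hN.le),
      ← Finset.sum_sub_distrib]
    simp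
  cadlag := by
    filter_upwards [hXV, ae_all_iff.2 hc] with ω hω hcω
    refine IsCadlagPath.congr fun T ↦ ?_
    obtain ⟨N, hN⟩ := hbt T
    exact ⟨_, IsCadlagPath.sum (fun k ↦ ((hcω k).comp_clip (b k) (b (k + 1))).sub_const
      (L k (V (b k) ω))) (Finset.range N), fun t ht ↦ hω N t (ht.trans hN).le⟩

/-- If moreover `V` has stationary increments and the pattern repeats after `m` intervals, the
increments of the concatenation are periodic. -/
lemma identDistrib_concat_add {F : Type*} [NormedAddCommGroup F] [NormedSpace ℝ F]
    [MeasurableSpace F] [BorelSpace F] [SecondCountableTopology F]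
    {X : ℝ≥0 → Ω → EuclideanSpace ℝ (Fin d)} {V : ℝ≥0 → Ω → F}
    {L : ℕ → F →L[ℝ] EuclideanSpace ℝ (Fin d)} {b : ℕ → ℝ≥0} {p : ℝ≥0} {m : ℕ}
    (hb : Monotone b) (hb0 : b 0 = 0) (hbt : ∀ t, ∃ N, t < b N)
    (hXV : ∀ᵐ ω ∂P, ∀ N, ∀ t ≤ b N, X t ω = ∑ k ∈ Finset.range N,
      (L k (V (clip (b k) (b (k + 1)) t) ω) - L k (V (b k) ω)))
    (mX : ∀ t, AEMeasurable (X t) P) (hV : HasIndepIncrements V P)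
    (hstat : ∀ s t, IdentDistrib (fun ω ↦ V (t + p) ω - V (s + p) ω) (fun ω ↦ V t ω - V s ω) P P)
    (hbp : ∀ k, b (m + k) = b k + p) (hL : ∀ k, L (m + k) = L k) (s t : ℝ≥0) :
    IdentDistrib (fun ω ↦ X (t + p) ω - X (s + p) ω) (fun ω ↦ X t ω - X s ω) P P := by
  wlog hst : s ≤ t generalizing s t
  · simpa [Function.comp_def] using (this t s (le_of_not_ge hst)).comp measurable_neg
  obtain ⟨N, hN⟩ := hbt t
  have ht : Monotone ![s, t] := by
    refine Fin.monotone_iff_le_succ.2 fun i ↦ ?_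
    fin_cases i
    simpa using hst
  have h1 := (HasIndepIncrements_clip hV hb ht).precomp (g := fun k : ℕ ↦ ((0 : Fin 1), k))
    (Prod.mk_right_injective 0)
  have h2 := (HasIndepIncrements_clip
    (HasIndepIncrements_comp_monotone hV (φ := fun t ↦ t + p) fun _ _ h ↦ by
      dsimp only; gcongr) hb ht).precomp (g := fun k : ℕ ↦ ((0 : Fin 1), k))
    (Prod.mk_right_injective 0)
  -- Pieces are independent both before and after the shift, so equality of the single laws gives
  -- equality of the joint laws.
  have h3 := (IdentDistrib.pi (fun k ↦ hstat _ _) h2 h1).comp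
    (u := fun x ↦ ∑ k ∈ Finset.range N, L k (x k))
    (Finset.measurable_sum _ fun k _ ↦ (L k).measurable.comp (measurable_pi_apply k))
  have e1 : (fun ω ↦ X t ω - X s ω) =ᵐ[P] fun ω ↦ ∑ k ∈ Finset.range N,
      L k (V (clip (b k) (b (k + 1)) t) ω - V (clip (b k) (b (k + 1)) s) ω) := by
    filter_upwards [hXV] with ω hω
    rw [hω N t hN.le, hω N s (hst.trans hN.le), ← Finset.sum_sub_distrib]
    simp
  have e2 : (fun ω ↦ X (t + p) ω - X (s + p) ω) =ᵐ[P] fun ω ↦ ∑ k ∈ Finset.range N,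
      L k (V (clip (b k) (b (k + 1)) t + p) ω - V (clip (b k) (b (k + 1)) s + p) ω) := by
    filter_upwards [hXV] with ω hω
    have hbm : b m = p := by simpa [hb0] using hbp 0
    have hNp : t + p ≤ b (m + N) := by rw [hbp]; gcongr
    -- The first `m` cells fill `[0, p]` and contribute nothing after time `p`; the others are the
    -- original cells shifted by `p`.
    rw [hω _ _ hNp, hω (m + N) (s + p) (le_trans (by gcongr) hNp), ← Finset.sum_sub_distrib,
      Finset.sum_range_add, Finset.sum_eq_zero, zero_add]
    · refine Finset.sum_congr rfl fun k _ ↦ ?_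
      rw [add_assoc m k 1, hbp, hbp, hL, clip_add, clip_add, map_sub, sub_sub_sub_cancel_right]
    · intro k hk
      have h4 : b (k + 1) ≤ p := hbm ▸ hb (Finset.mem_range.1 hk)
      rw [clip_of_ge (hb k.le_succ) (h4.trans le_add_self),
        clip_of_ge (hb k.le_succ) (h4.trans le_add_self), sub_self]
  exact ((IdentDistrib.of_ae_eq ((mX _).sub (mX _)) e2).trans h3).trans
    (IdentDistrib.of_ae_eq ((mX _).sub (mX _)) e1).symm

end Concatenation

/-! ### The alternating process and the time-changed sum. -/

section Alternating

/-- The times `0, q, p, p + q, 2p, ...` at which the alternation switches. -/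
noncomputable def switchTime (p q : ℝ≥0) (k : ℕ) : ℝ≥0 := (k / 2 : ℕ) * p + (k % 2 : ℕ) * q

lemma switchTime_even (p q : ℝ≥0) (n : ℕ) : switchTime p q (2 * n) = n * p := by
  simp [switchTime]

lemma switchTime_odd (p q : ℝ≥0) (n : ℕ) : switchTime p q (2 * n + 1) = n * p + q := by
  have h : (2 * n + 1) / 2 = n := by omega
  simp [switchTime, h]

lemma switchTime_two_add (p q : ℝ≥0) (k : ℕ) : switchTime p q (2 + k) = switchTime p q k + p := by
  have h : (2 + k) / 2 = k / 2 + 1 := by omega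
  simp only [switchTime, h, Nat.add_mod_left]
  push_cast
  ring

lemma monotone_switchTime {p q : ℝ≥0} (hqp : q ≤ p) : Monotone (switchTime p q) := by
  refine monotone_nat_of_le_succ fun k ↦ ?_
  obtain ⟨n, rfl | rfl⟩ := k.even_or_odd'
  · rw [switchTime_even, switchTime_odd]
    exact le_self_add
  · rw [switchTime_odd, show 2 * n + 1 + 1 = 2 * (n + 1) by ring, switchTime_even]
    push_cast
    rw [add_one_mul]
    gcongr

lemma exists_lt_switchTime {p q : ℝ≥0} (hp : 0 < p) (t : ℝ≥0) : ∃ N, t < switchTime p q N := by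
  refine ⟨2 * (⌊t / p⌋₊ + 1), ?_⟩
  rw [switchTime_even, ← div_lt_iff₀ hp]
  exact_mod_cast Nat.lt_floor_add_one (t / p)

variable {Ω : Type*} [MeasurableSpace Ω] {P : Measure Ω} {d : ℕ}
  {X Y Z : ℝ≥0 → Ω → EuclideanSpace ℝ (Fin d)} {p q : ℝ≥0}

/-- The projection to the process followed on the `k`-th interval. -/
noncomputable def switchProj (d k : ℕ) :
    EuclideanSpace ℝ (Fin d) × EuclideanSpace ℝ (Fin d) →L[ℝ] EuclideanSpace ℝ (Fin d) :=
  if k % 2 = 0 then .fst ℝ _ _ else .snd ℝ _ _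

lemma switchProj_apply (k : ℕ) (y z : EuclideanSpace ℝ (Fin d)) :
    switchProj d k (y, z) = if k % 2 = 0 then y else z := by
  unfold switchProj
  split_ifs <;> rfl

/-- Turns the recursive description into the form required by `isAdditiveProcess_concat` and
`identDistrib_concat_add` with `V = (Y, Z)`. -/
lemma IsAlternating.eq_sum (hX : IsAlternating X Y Z p q P) (hqp : q ≤ p) :
    ∀ᵐ ω ∂P, ∀ N, ∀ t ≤ switchTime p q N, X t ω = ∑ k ∈ Finset.range N,
      (switchProj d k (Y (clip (switchTime p q k) (switchTime p q (k + 1)) t) ω,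
          Z (clip (switchTime p q k) (switchTime p q (k + 1)) t) ω) -
        switchProj d k (Y (switchTime p q k) ω, Z (switchTime p q k) ω)) := by
  filter_upwards [hX] with ω hω N
  refine eq_sum_clip (x := fun t ↦ X t ω) (y := fun k t ↦ switchProj d k (Y t ω, Z t ω))
    (monotone_switchTime hqp) (by simp [switchTime]) hω.1 (fun k t h1 h2 ↦ ?_) N
  -- `IsAlternating` excludes left endpoints, where the identity is trivial.
  rcases h1.eq_or_lt with rfl | h1
  · simp
  obtain ⟨n, rfl | rfl⟩ := k.even_or_odd'
  · rw [switchTime_even] at h1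
    rw [switchTime_odd] at h2
    simpa [switchTime_even, switchProj_apply, add_sub_assoc] using (hω.2 n t).1 h1 h2
  · rw [switchTime_odd] at h1
    rw [show 2 * n + 1 + 1 = 2 * (n + 1) by ring, switchTime_even, Nat.cast_succ] at h2
    simpa [switchTime_odd, switchProj_apply, add_sub_assoc, Nat.mul_add_mod]
      using (hω.2 n t).2 h1 h2

lemma IsLevyProcess.isSemiLevyProcess (hY : IsLevyProcess Y P) (hp : 0 < p) :
    IsSemiLevyProcess Y p P where
  toIsAdditiveProcess := hY.toIsAdditiveProcess
  period_pos := hp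
  periodicIncrements := hY.stationaryIncrements p

variable [IsProbabilityMeasure P]

/-- Increments of independent processes which have pairwise the same laws have the same joint
law. -/
lemma identDistrib_pair_sub
    (hYZ : IndepFun (fun ω t ↦ Y t ω) (fun ω t ↦ Z t ω) P) {s t s' t' u v u' v' : ℝ≥0}
    (hY : IdentDistrib (fun ω ↦ Y t ω - Y s ω) (fun ω ↦ Y t' ω - Y s' ω) P P)
    (hZ : IdentDistrib (fun ω ↦ Z v ω - Z u ω) (fun ω ↦ Z v' ω - Z u' ω) P P) :
    IdentDistrib (fun ω ↦ (Y t ω - Y s ω, Z v ω - Z u ω))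
      (fun ω ↦ (Y t' ω - Y s' ω, Z v' ω - Z u' ω)) P P := by
  have h (s t u v : ℝ≥0) : IndepFun (fun ω ↦ Y t ω - Y s ω) (fun ω ↦ Z v ω - Z u ω) P :=
    hYZ.comp (φ := fun y : ℝ≥0 → EuclideanSpace ℝ (Fin d) ↦ y t - y s)
      (ψ := fun z : ℝ≥0 → EuclideanSpace ℝ (Fin d) ↦ z v - z u) (by fun_prop) (by fun_prop)
  exact hY.prodMk hZ (h _ _ _ _) (h _ _ _ _)

lemma IsAlternating.isSemiLevyProcess (hX : IsAlternating X Y Z p q P)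
    (hY : IsLevyProcess Y P) (hZ : IsLevyProcess Z P)
    (hYZ : IndepFun (fun ω t ↦ Y t ω) (fun ω t ↦ Z t ω) P) (hp : 0 < p) (hqp : q ≤ p) :
    IsSemiLevyProcess X p P := by
  have hV : HasIndepIncrements (fun t ω ↦ (Y t ω, Z t ω)) P :=
    HasIndepIncrements_prodMk hY.indepIncrements hZ.indepIncrements hYZ hY.aemeasurable
      hZ.aemeasurable monotone_id monotone_id
  have hadd : IsAdditiveProcess X P := by
    refine isAdditiveProcess_concat (V := fun t ω ↦ (Y t ω, Z t ω))
      (L := switchProj d) (b := switchTime p q) (monotone_switchTime hqp) (exists_lt_switchTime hp)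
      (hX.eq_sum hqp) (fun t ↦ (hY.aemeasurable t).prodMk (hZ.aemeasurable t)) hV
      (fun k t ↦ ?_) fun k ↦ ?_
    · simp only [switchProj_apply]
      split_ifs
      exacts [hY.stochasticallyContinuous t, hZ.stochasticallyContinuous t]
    · simp only [switchProj_apply]
      split_ifs
      exacts [hY.cadlag, hZ.cadlag]
  exact
    { toIsAdditiveProcess := hadd
      period_pos := hp
      periodicIncrements := identDistrib_concat_add (V := fun t ω ↦ (Y t ω, Z t ω))
        (L := switchProj d) (b := switchTime p q) (m := 2) (monotone_switchTime hqp)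
        (by simp [switchTime]) (exists_lt_switchTime hp) (hX.eq_sum hqp) hadd.aemeasurable hV
        (fun s t ↦ identDistrib_pair_sub hYZ
          (hY.stationaryIncrements p s t) (hZ.stationaryIncrements p s t))
        (switchTime_two_add p q) (fun k ↦ by simp [switchProj]) }

lemma IsLevyProcess.add_comp_mul (hY : IsLevyProcess Y P) (hZ : IsLevyProcess Z P)
    (hYZ : IndepFun (fun ω t ↦ Y t ω) (fun ω t ↦ Z t ω) P) {a b : ℝ≥0} (ha : 0 < a) (hb : 0 < b) :
    IsLevyProcess (fun t ω ↦ Y (a * t) ω + Z (b * t) ω) P where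
  aemeasurable t := (hY.aemeasurable _).add (hZ.aemeasurable _)
  zero := by
    filter_upwards [hY.zero, hZ.zero] with ω h1 h2
    simp [h1, h2]
  stochasticallyContinuous t := tendstoInMeasure_add
    (tendstoInMeasure_comp_continuous hY.stochasticallyContinuous (continuous_const_mul a) t)
    (tendstoInMeasure_comp_continuous hZ.stochasticallyContinuous (continuous_const_mul b) t)
  indepIncrements := by
    have h := HasIndepIncrements_prodMk hY.indepIncrements hZ.indepIncrements hYZ hY.aemeasurable
      hZ.aemeasurable (φ := fun t ↦ a * t) (ψ := fun t ↦ b * t)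
      (fun _ _ h ↦ mul_le_mul_right h a) (fun _ _ h ↦ mul_le_mul_right h b)
    exact h.map (ContinuousLinearMap.coprod (.id ℝ (EuclideanSpace ℝ (Fin d)))
      (.id ℝ (EuclideanSpace ℝ (Fin d))))
  cadlag := by
    filter_upwards [hY.cadlag, hZ.cadlag] with ω h1 h2
    exact (h1.comp_mul ha).add (h2.comp_mul hb)
  stationaryIncrements h s t := by
    have h1 := (identDistrib_pair_sub hYZ
      (hY.stationaryIncrements (a * h) (a * s) (a * t))
      (hZ.stationaryIncrements (b * h) (b * s) (b * t))).comp
      (u := fun z ↦ z.1 + z.2) (by fun_prop)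
    simp only [Function.comp_def, sub_add_sub_comm, ← mul_add] at h1
    exact h1

/-- The alternating process at time `p` has the law of `Y q + Z (p - q)`. -/
lemma IsAlternating.identDistrib_period (hX : IsAlternating X Y Z p q P)
    (hY : IsLevyProcess Y P) (hZ : IsLevyProcess Z P)
    (hYZ : IndepFun (fun ω t ↦ Y t ω) (fun ω t ↦ Z t ω) P) (hq : 0 < q) (hqp : q < p)
    (hXp : AEMeasurable (X p) P) :
    IdentDistrib (X p) (fun ω ↦ Y q ω + Z (p - q) ω) P P := by
  have hZ' := hZ.stationaryIncrements q 0 (p - q)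
  rw [tsub_add_cancel_of_le hqp.le, zero_add] at hZ'
  have h1 := (identDistrib_pair_sub hYZ
    (IdentDistrib.refl (hY.aemeasurable_sub 0 q)) hZ').comp
    (u := fun z ↦ z.1 + z.2) (by fun_prop)
  refine (IdentDistrib.of_ae_eq hXp ?_).trans (h1.trans (IdentDistrib.of_ae_eq
    h1.aemeasurable_snd ?_))
  · filter_upwards [hX] with ω hω
    have e1 := (hω.2 0 q).1 (by simpa using hq) (by simp)
    have e2 := (hω.2 0 p).2 (by simpa using hqp) (by simp)
    simp only [Nat.cast_zero, zero_mul, zero_add, hω.1] at e1 e2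
    simp only [Function.comp_apply]
    rw [e2, e1, add_sub_assoc]
  · filter_upwards [hY.zero, hZ.zero] with ω hy hz
    simp [hy, hz]

end Alternating

theorem proposition4p1 {Ω : Type*} [MeasurableSpace Ω] (P : Measure Ω) [IsProbabilityMeasure P]
    (d : ℕ) (X Y Z : ℝ≥0 → Ω → EuclideanSpace ℝ (Fin d))
    (hY : IsLevyProcess Y P) (hZ : IsLevyProcess Z P)
    (hYZ : IndepFun (fun ω t ↦ Y t ω) (fun ω t ↦ Z t ω) P)
    (p q : ℝ≥0) (hq : 0 < q) (hqp : q < p) (hX : IsAlternating X Y Z p q P) :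
    IsSemiLevyProcess X p P ∧
      IsLevyProcess (fun t ω ↦ Y (q * t) ω + Z ((p - q) * t) ω) P ∧
      (IsRecurrentProcess X P ↔
        IsRecurrentProcess (fun t ω ↦ Y (q * t) ω + Z ((p - q) * t) ω) P) := by
  have hS := hX.isSemiLevyProcess hY hZ hYZ (hq.trans hqp) hqp.le
  have hW := hY.add_comp_mul hZ hYZ hq (tsub_pos_of_lt hqp)
  refine ⟨hS, hW, ?_⟩
  -- With period `1`, the embedded walk of the sum has step `Y q + Z (p - q)`.
  rw [hS.isRecurrentProcess_iff, (hW.isSemiLevyProcess one_pos).isRecurrentProcess_iff,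
    (hX.identDistrib_period hY hZ hYZ hq hqp (hS.aemeasurable p)).map_eq]
  simp only [mul_one]
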